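/- Fix an integer $k\ge 2$. A deterministic finite automaton with output (DFAO) over the input alphabet $\{0,1,\dots,k-1\}$ generates an infinite sequence $\mathbf{x}=a(0)a(1)a(2)\cdots$ as follows: $a(n)$ is the output letter of the last state reached when the automaton reads, most significant digit first, the base-$k$ representation of $n$ without leading zeros (the empty word if $n=0$). The sequences over finite alphabets obtained in this way are the $k$-automatic sequences; letters are coded by natural numbers. In the decision problems below, a $k$-automatic sequence is given by (the finite table describing) a DFAO that generates it. If a finite word $w$ can be written as $w=u^n u'$ with $u$ a nonempty word, $n\ge 1$ an integer and $u'$ a prefix of $u$, then $w$ is a (fractional) power with exponent $|w|/|u|$. The largest such exponent is the exponent of $w$, and the critical exponent of $\mathbf{x}$ is the supremum of the exponents of its finite nonempty factors. A word $w$ is bordered if it begins and ends with the same word $u$ for some $u$ with $0<|u|\le |w|/2$; otherwise it is unbordered. Theorem. The following hold. 1. A $k$-automatic sequence $\mathbf{x}$ has infinite critical exponent if and only if it contains powers of arbitrarily large exponent (that is, for every $C$ it has a factor that is a power with some exponent $\ge C$), and the following question is decidable: given a $k$-automatic sequence $\mathbf{x}$, does $\mathbf{x}$ contain powers of arbitrarily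 large exponent? 2. The following question is decidable: given a $k$-automatic sequence $\mathbf{x}$, does $\mathbf{x}$ contain arbitrarily long unbordered factors (that is, for every $N$, an unbordered factor of length at least $N$)? -/

import Mathlib

open scoped ENNReal

/-- A deterministic finite automaton with output: input alphabet `Σ_k = {0, …, k-1}`, states
`0, …, numStates - 1`, and an output letter (coded by a natural number) attached to each state. -/
structure DFAO (k : ℕ) where
  /-- the number of states (positive, as there is a start state) -/
  numStates : ℕ
  /-- the start state -/
  start : Fin numStates
  /-- the transition function -/
  step : Fin numStates → Fin k → Fin numStates
  /-- the letter contained in each state -/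
  output : Fin numStates → ℕ

/-- The canonical base-`k` representation of `n`: most significant digit first, no leading
zeros, so that `0` is represented by the empty word. -/
def canonicalRep (k : ℕ) (hk : 2 ≤ k) (n : ℕ) : List (Fin k) :=
  ((Nat.digits k n).pmap (fun d (hd : d < k) => (⟨d, hd⟩ : Fin k))
    (fun _ hd => Nat.digits_lt_base hk hd)).reverse

namespace DFAO

variable {k : ℕ}

/-- The state reached from the start state after reading the word `w` from left to right. -/
def run (M : DFAO k) (w : List (Fin k)) : Fin M.numStates :=
  w.foldl M.step M.start

/-- The `k`-automatic sequence generated by `M`: its `n`-th term is the output of the last state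
reached on the base-`k` representation of `n`. -/
def sequence (M : DFAO k) (hk : 2 ≤ k) (n : ℕ) : ℕ :=
  M.output (M.run (canonicalRep k hk n))

/-- The explicit finite description of an automaton: its start state, and the table that lists,
for each state, the row of its transitions and its output. -/
def code (M : DFAO k) : ℕ × List (List ℕ × ℕ) :=
  ((M.start : ℕ),
    List.ofFn fun q => (List.ofFn fun a => ((M.step q a : Fin M.numStates) : ℕ), M.output q))

/-- Distinct automata have distinct descriptions. -/
theorem code_injective : Function.Injective (code (k := k)) := by
  rintro ⟨n, s, δ, o⟩ ⟨n', s', δ', o'⟩ h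
  simp only [code, Prod.mk.injEq] at h
  obtain ⟨h1, h2⟩ := h
  obtain rfl : n = n' := by simpa using congrArg List.length h2
  have h3 := List.ofFn_injective h2
  obtain rfl : s = s' := Fin.ext h1
  have h4 : δ = δ' := by
    funext q a
    have := List.ofFn_injective (Prod.ext_iff.1 (congrFun h3 q)).1
    exact Fin.ext (congrFun this a)
  have h5 : o = o' := by
    funext q
    exact (Prod.ext_iff.1 (congrFun h3 q)).2
  subst h4 h5
  rfl

/-- A property of automata is decidable if the set of descriptions of the automata that have the
property is decidable, i.e. its characteristic function is a total recursive function. -/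
def IsDecidable (P : DFAO k → Prop) : Prop :=
  ComputablePred fun c : ℕ × List (List ℕ × ℕ) => ∃ M : DFAO k, M.code = c ∧ P M

end DFAO

/-- The factor `x[i..i+n-1]` of length `n` beginning at position `i`. -/
def factor {α : Type*} (x : ℕ → α) (i n : ℕ) : List α :=
  (List.range n).map fun t => x (i + t)

/-- `w` is a fractional power with exponent `e`: it can be written as `u^n u'` with `n ≥ 1` and
`u'` a prefix of the nonempty word `u`, where `e = |w| / |u|`. -/
def IsFractionalPower {α : Type*} (w : List α) (e : ℚ) : Prop :=
  ∃ (u u' : List α) (n : ℕ), u ≠ [] ∧ 1 ≤ n ∧ u' <+: u ∧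
    w = (List.replicate n u).flatten ++ u' ∧ e = (w.length : ℚ) / (u.length : ℚ)

/-- The exponent of a word: the largest `e` such that the word is a fractional power with
exponent `e` (and `0` for the empty word, which is no fractional power). -/
noncomputable def wordExponent {α : Type*} (w : List α) : ℝ≥0∞ :=
  ⨆ (e : ℚ) (_ : IsFractionalPower w e), ENNReal.ofReal (e : ℝ)

/-- The critical exponent of `x`: the supremum of the exponents of its finite factors. -/
noncomputable def criticalExponent {α : Type*} (x : ℕ → α) : ℝ≥0∞ :=
  ⨆ (i : ℕ) (n : ℕ), wordExponent (factor x i n)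

/-- `x` contains fractional powers of arbitrarily large exponent. -/
def HasArbitrarilyLargePowers {α : Type*} (x : ℕ → α) : Prop :=
  ∀ C : ℚ, ∃ (i n : ℕ) (e : ℚ), C ≤ e ∧ IsFractionalPower (factor x i n) e

/-- `w` is bordered: it begins and ends with the same word `u`, where `0 < |u| ≤ |w| / 2`. -/
def IsBordered {α : Type*} (w : List α) : Prop :=
  ∃ u : List α, 0 < u.length ∧ 2 * u.length ≤ w.length ∧ u <+: w ∧ u <:+ w

/-- `x` contains arbitrarily long unbordered factors. -/
def HasArbitrarilyLongUnbordered {α : Type*} (x : ℕ → α) : Prop :=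
  ∀ N : ℕ, ∃ i n : ℕ, N ≤ n ∧ ¬ IsBordered (factor x i n)

/-!
Both properties can be expressed by quantified formulas whose atoms are linear inequalities between
natural numbers and equalities between terms of the sequence. An automaton that reads the base-`k`
digits of all variables in parallel recognizes each atom, and recognizable relations are closed
under Boolean operations and, by the subset construction, under quantification. By pumping, if
`y` has at least `N` digits more than each of the parameters `v` and satisfies a relation `R v y`
recognized with `N` states, then so do a smaller and a larger number. The smaller one bounds the
search for a witness, so a formula can be evaluated knowing only how many states suffice for
its subformulas. The larger one shows that a period `p` carried by a factor of length
`n ≥ k ^ (N + 1) * p` is carried by arbitrarily long factors, so that powers of arbitrarily large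
exponent exist if and only if some fixed `p` is a period of arbitrarily long factors; unlike the
bound on the exponent, this can be expressed without multiplication.
-/

section Words

variable {α : Type*} {w : List α} {p : ℕ}

theorem hasPeriod_iff_drop_prefix : w.HasPeriod p ↔ w.drop p <+: w := by
  rw [← List.prefix_append_right_inj (w.take p), List.take_append_drop, List.HasPeriod]

theorem prefix_append_self_iff {u : List α} (hu : u ≠ []) :
    w <+: u ++ w ↔ ∃ n u', u' <+: u ∧ w = (List.replicate n u).flatten ++ u' := by
  constructor
  · intro h
    induction hl : w.length using Nat.strong_induction_on generalizing w with
    | _ l ih =>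
      rcases List.prefix_or_prefix_of_prefix h (List.prefix_append u w) with hw | ⟨v, rfl⟩
      · exact ⟨0, w, hw, by simp⟩
      · have hlt : v.length < l := by
          simp [← hl, List.length_pos_iff_ne_nil.2 hu]
        obtain ⟨n, u', hu', hv'⟩ := ih _ hlt ((List.prefix_append_right_inj u).1 h) rfl
        exact ⟨n + 1, u', hu', by
          rw [List.replicate_succ, List.flatten_cons, List.append_assoc, ← hv']⟩
  · rintro ⟨n, u', hu', rfl⟩
    rw [← List.append_assoc, ← List.flatten_cons, ← List.replicate_succ, List.replicate_succ',
      List.flatten_concat, List.append_assoc, List.prefix_append_right_inj]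
    exact hu'.trans (List.prefix_append _ _)

theorem isFractionalPower_iff {e : ℚ} :
    IsFractionalPower w e ↔
      ∃ p, 0 < p ∧ p ≤ w.length ∧ w.HasPeriod p ∧ e = (w.length : ℚ) / (p : ℚ) := by
  constructor
  · rintro ⟨u, u', n, hu, hn, hu', hw, he⟩
    obtain ⟨n, rfl⟩ := Nat.exists_eq_add_of_le' hn
    obtain ⟨v, rfl⟩ : u <+: w := by simp [hw, List.replicate_succ, List.append_assoc]
    refine ⟨u.length, List.length_pos_iff_ne_nil.2 hu, by simp, ?_, he⟩
    rw [List.HasPeriod, List.take_left]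
    exact (prefix_append_self_iff hu).2 ⟨n + 1, u', hu', hw⟩
  · rintro ⟨p, hp, hpw, hper, he⟩
    have hu : w.take p ≠ [] := by
      rw [← List.length_pos_iff_ne_nil, List.length_take]
      omega
    have hdrop : w.drop p <+: w.take p ++ w.drop p := by
      rw [List.take_append_drop]
      exact hasPeriod_iff_drop_prefix.1 hper
    obtain ⟨n, u', hu', hw⟩ := (prefix_append_self_iff hu).1 hdrop
    refine ⟨w.take p, u', n + 1, hu, by omega, hu', ?_, by rwa [List.length_take_of_le hpw]⟩
    rw [List.replicate_succ, List.flatten_cons, List.append_assoc, ← hw, List.take_append_drop]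

theorem isBordered_iff_hasPeriod :
    IsBordered w ↔ ∃ p, w.length ≤ p + p ∧ p < w.length ∧ w.HasPeriod p := by
  simp only [hasPeriod_iff_drop_prefix]
  constructor
  · rintro ⟨u, hpos, hle, hpre, hsuf⟩
    refine ⟨w.length - u.length, by omega, by omega, ?_⟩
    rwa [← List.suffix_iff_eq_drop.1 hsuf]
  · rintro ⟨p, hle, hlt, hpre⟩
    exact ⟨w.drop p, by simp [hlt], by simp; omega, hpre, List.drop_suffix p w⟩

variable {x : ℕ → α} {i n : ℕ}

@[simp]
theorem length_factor : (factor x i n).length = n := by simp [factor]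

theorem hasPeriod_factor_iff :
    (factor x i n).HasPeriod p ↔ ∀ t, t + p < n → x (i + t) = x (i + (t + p)) := by
  rw [List.hasPeriod_iff_getElem?, length_factor]
  refine forall_congr' fun t => ?_
  rw [Nat.lt_sub_iff_add_lt]
  refine imp_congr_right fun ht => ?_
  have ht' : t < n := by omega
  simp [factor, ht, ht']

theorem hasArbitrarilyLargePowers_iff :
    HasArbitrarilyLargePowers x ↔
      ∀ C : ℕ, ∃ n p, 0 < p ∧ C * p ≤ n ∧ ∃ i, (factor x i n).HasPeriod p := by
  simp only [HasArbitrarilyLargePowers, isFractionalPower_iff, length_factor]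
  constructor
  · intro h C
    obtain ⟨i, n, _, hC, p, hp, -, hper, rfl⟩ := h C
    rw [le_div_iff₀ (by positivity)] at hC
    exact ⟨n, p, hp, by exact_mod_cast hC, i, hper⟩
  · intro h C
    obtain ⟨m, hm⟩ := exists_nat_ge C
    obtain ⟨n, p, hp, hn, i, hper⟩ := h (m + 1)
    refine ⟨i, n, n / p, ?_, p, hp, (Nat.le_mul_of_pos_left p m.succ_pos).trans hn, hper, rfl⟩
    rw [le_div_iff₀ (by positivity)]
    calc C * p ≤ (m + 1) * p := by gcongr; linarith
      _ ≤ n := by exact_mod_cast hn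

theorem criticalExponent_eq_top_iff : criticalExponent x = ⊤ ↔ HasArbitrarilyLargePowers x := by
  constructor
  · intro h C
    have hC : ENNReal.ofReal C < criticalExponent x := h ▸ ENNReal.ofReal_lt_top
    simp only [criticalExponent, wordExponent, lt_iSup_iff] at hC
    obtain ⟨i, n, e, he, hlt⟩ := hC
    exact ⟨i, n, e, by exact_mod_cast (ENNReal.ofReal_lt_ofReal_iff'.1 hlt).1.le, he⟩
  · intro h
    refine ENNReal.eq_top_of_forall_nnreal_le fun r => ?_
    obtain ⟨C, hC⟩ := exists_rat_gt (r : ℝ)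
    obtain ⟨i, n, e, hCe, he⟩ := h C
    calc (r : ℝ≥0∞) = ENNReal.ofReal r := (ENNReal.ofReal_coe_nnreal).symm
      _ ≤ ENNReal.ofReal e := ENNReal.ofReal_le_ofReal (hC.le.trans (by exact_mod_cast hCe))
      _ ≤ wordExponent (factor x i n) := le_iSup₂_of_le e he le_rfl
      _ ≤ criticalExponent x := le_iSup₂ (f := fun i n => wordExponent (factor x i n)) i n

end Words

section Recognizable

variable {ι T T' : Type*} {k N N' n : ℕ}

/-- `c v` can serve as the state that a finite automaton reaches on the digits of the tuple `v`,
read in parallel and most significant digits first: after appending the digits `r` to those of `v`,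
it depends only on `r` and on its value at `v`. -/
def IsStateMap (k : ℕ) (c : (ι → ℕ) → T) : Prop :=
  ∀ ⦃v w r : ι → ℕ⦄, (∀ i, r i < k) → c v = c w → c (k • v + r) = c (k • w + r)

/-- `R` is recognized by an automaton with `N` states that reads tuples of natural numbers in
base `k`. -/
def IsRecognizable (k N : ℕ) (R : (ι → ℕ) → Prop) : Prop :=
  ∃ c : (ι → ℕ) → Fin N, IsStateMap k c ∧ ∀ v w, c v = c w → (R v ↔ R w)

namespace IsStateMap

theorem isRecognizable [Fintype T] {c : (ι → ℕ) → T} {R : (ι → ℕ) → Prop} (hc : IsStateMap k c)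
    (hR : ∀ v w, c v = c w → (R v ↔ R w)) : IsRecognizable k (Fintype.card T) R :=
  ⟨Fintype.equivFin T ∘ c, fun _ _ _ hr h => by simpa using hc hr (by simpa using h),
    fun v w h => hR v w (by simpa using h)⟩

protected theorem prodMk {c : (ι → ℕ) → T} {c' : (ι → ℕ) → T'} (hc : IsStateMap k c)
    (hc' : IsStateMap k c') : IsStateMap k fun v => (c v, c' v) := by
  intro v w r hr h
  rw [Prod.mk.injEq] at h ⊢
  exact ⟨hc hr h.1, hc' hr h.2⟩

theorem pow {c : (ι → ℕ) → T} (hc : IsStateMap k c) (j : ℕ) : IsStateMap (k ^ j) c := by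
  induction j with
  | zero =>
    intro v w r hr h
    obtain rfl : r = 0 := funext fun i => by simpa using hr i
    simpa using h
  | succ j ih =>
    intro v w r hr h
    have hk : ∀ _ : ι, 0 < k := fun i =>
      Nat.pos_of_ne_zero fun h0 => by simpa [h0] using hr i
    have split : ∀ u : ι → ℕ, k ^ (j + 1) • u + r =
        k • (k ^ j • u + fun i => r i / k) + fun i => r i % k := by
      intro u
      funext i
      simp only [Pi.add_apply, Pi.smul_apply, smul_eq_mul]
      rw [mul_add, add_assoc, Nat.div_add_mod, pow_succ']
      ring
    rw [split, split]
    refine hc (fun i => Nat.mod_lt _ (hk i)) (ih (fun i => ?_) h)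
    exact Nat.div_lt_of_lt_mul (by simpa only [pow_succ'] using hr i)

/-- The subset construction: the automaton guesses the digits of the first coordinate. -/
theorem range_vecCons {c : (Fin (n + 1) → ℕ) → T} (hk : 0 < k) (hc : IsStateMap k c) :
    IsStateMap k fun v => Set.range fun y => c (Matrix.vecCons y v) := by
  have subset : ∀ v w r : Fin n → ℕ, (∀ i, r i < k) →
      (Set.range fun y => c (Matrix.vecCons y v)) ⊆ (Set.range fun y => c (Matrix.vecCons y w)) →
      (Set.range fun y => c (Matrix.vecCons y (k • v + r))) ⊆
        Set.range fun y => c (Matrix.vecCons y (k • w + r)) := by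
    rintro v w r hr h _ ⟨y, rfl⟩
    obtain ⟨z, hz⟩ := h ⟨y / k, rfl⟩
    have hd : ∀ i, Matrix.vecCons (y % k) r i < k := Fin.cases (Nat.mod_lt y hk) hr
    refine ⟨k * z + y % k, ?_⟩
    simpa [Nat.div_add_mod] using hc hd hz
  intro v w r hr h
  exact (subset v w r hr h.subset).antisymm (subset w v r hr h.symm.subset)

/-- Once the value of `D` leaves `[-C, C]`, appending digits cannot bring it back. -/
theorem projIcc {D : (ι → ℕ) →ₗ[ℕ] ℤ} {C : ℤ} (hC : 0 < C)
    (hD : ∀ r, (∀ i, r i < k) → |D r| ≤ (k - 1) * C) :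
    IsStateMap k fun v => Set.projIcc (-C) C (neg_le_self hC.le) (D v) := by
  intro v w r hr e
  obtain ⟨hr₁, hr₂⟩ := abs_le.1 (hD r hr)
  have hk : (0 : ℤ) ≤ k := k.cast_nonneg
  have map_append : ∀ u, D (k • u + r) = k * D u + D r := fun u => by
    rw [map_add, map_smul, nsmul_eq_mul]
  have large : ∀ u, C ≤ D u → C ≤ D (k • u + r) := fun u hu => by
    rw [map_append]
    linarith [mul_le_mul_of_nonneg_left hu hk]
  have small : ∀ u, D u ≤ -C → D (k • u + r) ≤ -C := fun u hu => by
    rw [map_append]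
    linarith [mul_le_mul_of_nonneg_left hu hk]
  have cases : D v = D w ∨ (C ≤ D v ∧ C ≤ D w) ∨ (D v ≤ -C ∧ D w ≤ -C) := by
    have e := congrArg Subtype.val e
    simp only [Set.coe_projIcc] at e
    omega
  rcases cases with h | ⟨hv, hw⟩ | ⟨hv, hw⟩
  · simp only [map_append, h]
  · simp only [Set.projIcc_of_right_le _ (large v hv), Set.projIcc_of_right_le _ (large w hw)]
  · simp only [Set.projIcc_of_le_left _ (small v hv), Set.projIcc_of_le_left _ (small w hw)]

end IsStateMap

namespace IsRecognizable

variable {R R' : (ι → ℕ) → Prop}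

protected theorem not (h : IsRecognizable k N R) : IsRecognizable k N fun v => ¬ R v := by
  obtain ⟨c, hc, hR⟩ := h
  exact ⟨c, hc, fun v w e => not_congr (hR v w e)⟩

protected theorem and (h : IsRecognizable k N R) (h' : IsRecognizable k N' R') :
    IsRecognizable k (N * N') fun v => R v ∧ R' v := by
  obtain ⟨c, hc, hR⟩ := h
  obtain ⟨c', hc', hR'⟩ := h'
  simpa using (hc.prodMk hc').isRecognizable fun v w e =>
    and_congr (hR v w (congrArg Prod.fst e)) (hR' v w (congrArg Prod.snd e))

protected theorem ex {R : (Fin n → ℕ) → ℕ → Prop} (hk : 0 < k)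
    (h : IsRecognizable k N fun v : Fin (n + 1) → ℕ => R (Matrix.vecTail v) (v 0)) :
    IsRecognizable k (2 ^ N) fun v => ∃ y, R v y := by
  obtain ⟨c, hc, hR⟩ := h
  have imp : ∀ v w : Fin n → ℕ,
      (Set.range fun y => c (Matrix.vecCons y v)) ⊆ (Set.range fun y => c (Matrix.vecCons y w)) →
      (∃ y, R v y) → ∃ y, R w y := by
    rintro v w e ⟨y, hy⟩
    obtain ⟨z, hz⟩ := e ⟨y, rfl⟩
    exact ⟨z, (hR _ _ hz).2 hy⟩
  simpa using (hc.range_vecCons hk).isRecognizable fun v w e =>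
    ⟨imp v w e.subset, imp w v e.symm.subset⟩

theorem le (hk : 0 < k) (f g : (ι → ℕ) →ₗ[ℕ] ℕ) :
    ∃ N, IsRecognizable k N fun v => f v ≤ g v := by
  have map_digits_le : ∀ (h : (ι → ℕ) →ₗ[ℕ] ℕ) r, (∀ i, r i < k) → h r ≤ (k - 1) * h 1 := by
    intro h r hr
    calc h r ≤ h r + h ((k - 1) • 1 - r) := Nat.le_add_right _ _
      _ = h ((k - 1) • 1) := by
        rw [← map_add, add_tsub_cancel_of_le fun i => by simpa using Nat.le_sub_one_of_lt (hr i)]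
      _ = (k - 1) * h 1 := by rw [map_smul, smul_eq_mul]
  let D : (ι → ℕ) →ₗ[ℕ] ℤ := (Nat.castAddMonoidHom ℤ).toNatLinearMap ∘ₗ g -
    (Nat.castAddMonoidHom ℤ).toNatLinearMap ∘ₗ f
  have hD : ∀ v, D v = g v - f v := fun v => rfl
  have hstate := IsStateMap.projIcc (k := k) (D := D) (C := f 1 + g 1 + 1) (by omega) <| by
    intro r hr
    have hf := map_digits_le f r hr
    have hg := map_digits_le g r hr
    zify [hk] at hf hg
    rw [hD, abs_le]
    constructor <;> nlinarith
  exact ⟨_, hstate.isRecognizable fun v w e => by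
    have e := congrArg Subtype.val e
    simp only [Set.coe_projIcc, hD] at e
    omega⟩

end IsRecognizable

end Recognizable

section Pumping

variable {T : Type*} {k N L n : ℕ}

theorem IsStateMap.vecCons_congr {c : (Fin (n + 1) → ℕ) → T} (hc : IsStateMap k c) {j q q' d : ℕ}
    {v : Fin n → ℕ} (hv : ∀ i, v i < k ^ j) (hd : d < k ^ j)
    (h : c (Matrix.vecCons q 0) = c (Matrix.vecCons q' 0)) :
    c (Matrix.vecCons (k ^ j * q + d) v) = c (Matrix.vecCons (k ^ j * q' + d) v) := by
  have hr : ∀ i, Matrix.vecCons d v i < k ^ j := Fin.cases hd hv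
  simpa using hc.pow j hr h

theorem div_pow_lt_div_pow {y a b : ℕ} (hk : 2 ≤ k) (hab : a < b) (hy : k ^ a ≤ y) :
    y / k ^ b < y / k ^ a := by
  rw [← Nat.add_sub_cancel' hab.le, pow_add, ← Nat.div_div_eq_div_mul]
  exact Nat.div_lt_self (Nat.div_pos hy (by positivity)) (Nat.one_lt_pow (by omega) (by omega))

namespace IsRecognizable

variable {R : (Fin n → ℕ) → ℕ → Prop} {v : Fin n → ℕ} {y : ℕ}

/-- Among the `N + 1` states reached by `y` after its leading digits, two coincide; the digits in
between can be cut or repeated, and the other entries of the tuple are still `0` there. -/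
theorem exists_lt_and_exists_gt (hk : 2 ≤ k)
    (h : IsRecognizable k N fun v : Fin (n + 1) → ℕ => R (Matrix.vecTail v) (v 0))
    (hv : ∀ i, v i < k ^ L) (hy : k ^ (L + N) ≤ y) (hR : R v y) :
    (∃ z < y, R v z) ∧ ∃ z > y, R v z := by
  obtain ⟨c, hc, hcR⟩ := h
  obtain ⟨s, t, hst, e⟩ := Fintype.exists_ne_map_eq_of_card_lt
    (fun s : Fin (N + 1) => c (Matrix.vecCons (y / k ^ (L + s)) 0)) (by simp)
  wlog hlt : s < t generalizing s t
  · exact this t s hst.symm e.symm (lt_of_le_of_ne (not_lt.1 hlt) hst.symm)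
  have hquot : y / k ^ (L + t) < y / k ^ (L + s) :=
    div_pow_lt_div_pow hk (by simpa using hlt)
      ((Nat.pow_le_pow_right (by omega) (by omega)).trans hy)
  have replace : ∀ (j : Fin (N + 1)) q, c (Matrix.vecCons (y / k ^ (L + j)) 0) =
      c (Matrix.vecCons q 0) → R v (k ^ (L + j) * q + y % k ^ (L + j)) := by
    intro j q hq
    have hv' : ∀ i, v i < k ^ (L + j) := fun i =>
      (hv i).trans_le (Nat.pow_le_pow_right (by omega) (by omega))
    have := hc.vecCons_congr hv' (Nat.mod_lt y (by positivity)) hq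
    rw [Nat.div_add_mod] at this
    exact (hcR _ _ this).1 hR
  refine ⟨⟨_, ?_, replace s _ e⟩, ⟨_, ?_, replace t _ e.symm⟩⟩
  · calc k ^ (L + s) * (y / k ^ (L + t)) + y % k ^ (L + s)
        < k ^ (L + s) * (y / k ^ (L + s)) + y % k ^ (L + s) := by gcongr
      _ = y := Nat.div_add_mod y _
  · calc y = k ^ (L + t) * (y / k ^ (L + t)) + y % k ^ (L + t) := (Nat.div_add_mod y _).symm
      _ < k ^ (L + t) * (y / k ^ (L + s)) + y % k ^ (L + t) := by gcongr

theorem exists_iff_exists_lt (hk : 2 ≤ k)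
    (h : IsRecognizable k N fun v : Fin (n + 1) → ℕ => R (Matrix.vecTail v) (v 0))
    (hv : ∀ i, v i < k ^ L) : (∃ y, R v y) ↔ ∃ y < k ^ (L + N), R v y := by
  classical
  refine ⟨fun hex => ⟨Nat.find hex, ?_, Nat.find_spec hex⟩, fun ⟨y, _, hy⟩ => ⟨y, hy⟩⟩
  by_contra! hle
  obtain ⟨z, hz, hRz⟩ := (h.exists_lt_and_exists_gt hk hv hle (Nat.find_spec hex)).1
  exact Nat.find_min hex hz hRz

theorem exists_iff_exists_lt_pow_sum (hk : 2 ≤ k)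
    (h : IsRecognizable k N fun v : Fin (n + 1) → ℕ => R (Matrix.vecTail v) (v 0))
    (v : Fin n → ℕ) : (∃ y, R v y) ↔ ∃ y < k ^ (∑ i, v i + N), R v y :=
  h.exists_iff_exists_lt hk fun i => (Nat.lt_pow_self hk).trans_le <|
    Nat.pow_le_pow_right (by omega) (Finset.single_le_sum_of_canonicallyOrdered (Finset.mem_univ i))

theorem exists_ge (hk : 2 ≤ k)
    (h : IsRecognizable k N fun v : Fin (n + 1) → ℕ => R (Matrix.vecTail v) (v 0))
    (hv : ∀ i, v i < k ^ L) (hy : k ^ (L + N) ≤ y) (hR : R v y) (B : ℕ) : ∃ z ≥ B, R v z := by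
  suffices ∃ z ≥ k ^ (L + N) + B, R v z from this.imp fun z => And.imp_left (by omega)
  induction B with
  | zero => exact ⟨y, hy, hR⟩
  | succ B ih =>
    obtain ⟨z, hz, hRz⟩ := ih
    obtain ⟨z', hz', hRz'⟩ := (h.exists_lt_and_exists_gt hk hv (by omega) hRz).2
    exact ⟨z', by omega, hRz'⟩

end IsRecognizable

end Pumping

section UniformlyRecognizable

variable {σ : Type*} [Primcodable σ] {k n : ℕ}

theorem primrec_finset_sum {ι : Type*} (s : Finset ι) {f : ι → σ → ℕ} (hf : ∀ i, Primrec (f i)) :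
    Primrec fun a => ∑ i ∈ s, f i a := by
  induction s using Finset.cons_induction with
  | empty => simpa using Primrec.const 0
  | cons i s hi ih => simpa using Primrec.nat_add.comp (hf i) ih

theorem primrec_linearMap (f : (Fin n → ℕ) →ₗ[ℕ] ℕ) : Primrec f :=
  (primrec_finset_sum Finset.univ fun i => Primrec.nat_mul.comp
    (Primrec.fin_app.comp .id (.const i)) (.const _)).of_eq fun v =>
      (LinearMap.pi_apply_eq_sum_univ f v).symm

theorem primrec_vecCons : Primrec₂ fun (y : σ) (v : Fin n → σ) => Matrix.vecCons y v := by
  have hentry : ∀ i, Primrec fun p : σ × (Fin n → σ) => Matrix.vecCons p.1 p.2 i :=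
    Fin.cases Primrec.fst fun i => (Primrec.fin_app.comp .snd (.const i)).of_eq fun _ => rfl
  exact Primrec.fin_curry.2 (Primrec.fin_curry₁.2 hentry).swap

/-- A family of relations on `Fin n → ℕ`, indexed by `s : σ`, that are recognizable in base `k`
and decidable uniformly in `s`. The bound on the number of states is what makes unbounded
quantifiers decidable, see `UniformlyRecognizable.ex`. -/
structure UniformlyRecognizable (k : ℕ) (R : σ → (Fin n → ℕ) → Prop) : Prop where
  exists_primrec_card : ∃ N : σ → ℕ, Primrec N ∧ ∀ s, IsRecognizable k (N s) (R s)
  primrecPred : PrimrecPred fun p : σ × (Fin n → ℕ) => R p.1 p.2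

namespace UniformlyRecognizable

variable {R R' : σ → (Fin n → ℕ) → Prop}

protected theorem congr (h : UniformlyRecognizable k R) (e : ∀ s v, R s v ↔ R' s v) :
    UniformlyRecognizable k R' := by
  obtain rfl : R = R' := funext₂ fun s v => propext (e s v)
  exact h

protected theorem not (h : UniformlyRecognizable k R) :
    UniformlyRecognizable k fun s v => ¬ R s v where
  exists_primrec_card := h.exists_primrec_card.imp fun _ hN => ⟨hN.1, fun s => (hN.2 s).not⟩
  primrecPred := h.primrecPred.not

protected theorem and (h : UniformlyRecognizable k R) (h' : UniformlyRecognizable k R') :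
    UniformlyRecognizable k fun s v => R s v ∧ R' s v where
  exists_primrec_card := by
    obtain ⟨N, hN, hR⟩ := h.exists_primrec_card
    obtain ⟨N', hN', hR'⟩ := h'.exists_primrec_card
    exact ⟨_, Primrec.nat_mul.comp hN hN', fun s => (hR s).and (hR' s)⟩
  primrecPred := h.primrecPred.and h'.primrecPred

protected theorem imp (h : UniformlyRecognizable k R) (h' : UniformlyRecognizable k R') :
    UniformlyRecognizable k fun s v => R s v → R' s v :=
  (h.and h'.not).not.congr fun _ _ => by tauto

theorem le (hk : 0 < k) (f g : (Fin n → ℕ) →ₗ[ℕ] ℕ) :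
    UniformlyRecognizable k fun (_ : σ) v => f v ≤ g v where
  exists_primrec_card :=
    (IsRecognizable.le hk f g).elim fun N hN => ⟨fun _ => N, .const N, fun _ => hN⟩
  primrecPred := Primrec.nat_le.comp ((primrec_linearMap f).comp .snd)
    ((primrec_linearMap g).comp .snd)

theorem lt (hk : 0 < k) (f g : (Fin n → ℕ) →ₗ[ℕ] ℕ) :
    UniformlyRecognizable k fun (_ : σ) v => f v < g v :=
  (le hk g f).not.congr fun _ _ => not_le

theorem eq (hk : 0 < k) (f g : (Fin n → ℕ) →ₗ[ℕ] ℕ) :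
    UniformlyRecognizable k fun (_ : σ) v => f v = g v :=
  ((le hk f g).and (le hk g f)).congr fun _ _ => le_antisymm_iff.symm

section Quantifiers

variable {R : σ → (Fin n → ℕ) → ℕ → Prop}

protected theorem ex (hk : 2 ≤ k)
    (h : UniformlyRecognizable k fun s v => R s (Matrix.vecTail v) (v 0)) :
    UniformlyRecognizable k fun s v => ∃ y, R s v y := by
  have pow : Primrec₂ ((· ^ ·) : ℕ → ℕ → ℕ) := Primrec₂.unpaired'.1 Nat.Primrec.pow
  obtain ⟨⟨N, hN, hR⟩, hdec⟩ := h
  refine ⟨⟨_, pow.comp (.const 2) hN, fun s => (hR s).ex (by omega)⟩, ?_⟩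
  have hbound : Primrec fun p : σ × (Fin n → ℕ) => k ^ (∑ i, p.2 i + N p.1) :=
    pow.comp (.const k) <| Primrec.nat_add.comp
      (primrec_finset_sum _ fun i => Primrec.fin_app.comp .snd (.const i)) (hN.comp .fst)
  have hrel : PrimrecRel fun y (p : σ × (Fin n → ℕ)) => R p.1 p.2 y :=
    (hdec.comp <| Primrec.pair (Primrec.fst.comp .snd) <|
      primrec_vecCons.comp .fst (Primrec.snd.comp .snd)).of_eq fun _ => by simp
  exact (hrel.exists_mem_list.comp (Primrec.list_range.comp hbound) .id).of_eq fun p => by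
    simpa only [List.mem_range, id_eq] using ((hR p.1).exists_iff_exists_lt_pow_sum hk p.2).symm

protected theorem all (hk : 2 ≤ k)
    (h : UniformlyRecognizable k fun s v => R s (Matrix.vecTail v) (v 0)) :
    UniformlyRecognizable k fun s v => ∀ y, R s v y :=
  (UniformlyRecognizable.ex (R := fun s v y => ¬ R s v y) hk h.not).not.congr fun _ _ =>
    not_exists_not

protected theorem subst (hk : 2 ≤ k) (f : (Fin n → ℕ) →ₗ[ℕ] ℕ)
    (h : UniformlyRecognizable k fun s v => R s (Matrix.vecTail v) (v 0)) :
    UniformlyRecognizable k fun s v => R s v (f v) :=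
  (UniformlyRecognizable.ex (R := fun s v y => y = f v ∧ R s v y) hk <|
    (eq (by omega) (LinearMap.proj 0) (f ∘ₗ LinearMap.funLeft ℕ ℕ Fin.succ)).and h).congr
      fun _ _ => exists_eq_left

end Quantifiers

end UniformlyRecognizable

end UniformlyRecognizable

section Automata

variable {k : ℕ}

theorem canonicalRep_mul_add (hk : 2 ≤ k) {n : ℕ} (r : Fin k) (h : k * n + r ≠ 0) :
    canonicalRep k hk (k * n + r) = canonicalRep k hk n ++ [r] := by
  have hdiv : (k * n + r) / k = n := by
    rw [Nat.mul_add_div (by omega), Nat.div_eq_of_lt r.2, add_zero]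
  simp [canonicalRep, Nat.digits_def' (show 1 < k by omega) (Nat.pos_of_ne_zero h), hdiv,
    Nat.mod_eq_of_lt r.2]

namespace DFAO

theorem run_canonicalRep_mul_add (M : DFAO k) (hk : 2 ≤ k) {n : ℕ} (r : Fin k)
    (h : k * n + r ≠ 0) :
    M.run (canonicalRep k hk (k * n + r)) = M.step (M.run (canonicalRep k hk n)) r := by
  rw [canonicalRep_mul_add hk r h, run, List.foldl_concat, run]

/-- The flag `n = 0` has to be part of the state because appending the digit `0` to the empty
word does not give the canonical representation of `0`. -/
theorem isStateMap_run (M : DFAO k) (hk : 2 ≤ k) {ι : Type*} (i : ι) :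
    IsStateMap k fun v : ι → ℕ => (decide (v i = 0), M.run (canonicalRep k hk (v i))) := by
  intro v w r hr e
  simp only [Prod.mk.injEq, decide_eq_decide] at e
  simp only [Pi.add_apply, Pi.smul_apply, smul_eq_mul, Prod.mk.injEq, decide_eq_decide]
  have hzero : k * v i + r i = 0 ↔ k * w i + r i = 0 := by
    simp only [Nat.add_eq_zero_iff, mul_eq_zero, e.1]
  refine ⟨hzero, ?_⟩
  by_cases hv : k * v i + r i = 0
  · rw [hv, hzero.1 hv]
  · rw [M.run_canonicalRep_mul_add hk ⟨r i, hr i⟩ hv,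
      M.run_canonicalRep_mul_add hk ⟨r i, hr i⟩ (mt hzero.2 hv), e.2]

theorem isRecognizable_sequence_eq (M : DFAO k) (hk : 2 ≤ k) {ι : Type*} (i j : ι) :
    IsRecognizable k ((2 * M.numStates) * (2 * M.numStates)) fun v =>
      M.sequence hk (v i) = M.sequence hk (v j) := by
  simpa using ((M.isStateMap_run hk i).prodMk (M.isStateMap_run hk j)).isRecognizable
    fun v w e => by
      simp only [Prod.mk.injEq] at e
      simp only [sequence, e.1.2, e.2.2]

theorem mem_range_code_iff {c : ℕ × List (List ℕ × ℕ)} :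
    c ∈ Set.range (code (k := k)) ↔ c.1 < c.2.length ∧
      ∀ row ∈ c.2, row.1.length = k ∧ ∀ q ∈ row.1, q < c.2.length := by
  constructor
  · rintro ⟨M, rfl⟩
    simp [code, List.mem_ofFn]
  · obtain ⟨start, rows⟩ := c
    rintro ⟨hstart, hrows⟩
    have hlen : ∀ q : Fin rows.length, k = rows[q].1.length := fun q =>
      (hrows _ (List.getElem_mem q.2)).1.symm
    refine ⟨⟨rows.length, ⟨start, hstart⟩, fun q a => ⟨rows[q].1[a]'(a.2.trans_eq (hlen q)), ?_⟩,
      fun q => rows[q].2⟩, ?_⟩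
    · exact (hrows _ (List.getElem_mem q.2)).2 _ (List.getElem_mem _)
    · refine Prod.ext rfl (List.ext_getElem (by simp [code]) fun i h₁ h₂ => ?_)
      simp only [code, List.getElem_ofFn]
      refine Prod.ext (List.ext_getElem ?_ fun j h₃ h₄ => ?_) rfl
      · simpa using hlen ⟨i, h₂⟩
      · simp

theorem primrecPred_mem_range_code :
    PrimrecPred fun c : ℕ × List (List ℕ × ℕ) => c ∈ Set.range (code (k := k)) := by
  have hlength : Primrec fun c : ℕ × List (List ℕ × ℕ) => c.2.length :=
    Primrec.list_length.comp .snd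
  have hentry : PrimrecRel fun q (c : ℕ × List (List ℕ × ℕ)) => q < c.2.length :=
    Primrec.nat_lt.comp .fst (hlength.comp .snd)
  have hrow : PrimrecRel fun (row : List ℕ × ℕ) (c : ℕ × List (List ℕ × ℕ)) =>
      row.1.length = k ∧ ∀ q ∈ row.1, q < c.2.length :=
    (Primrec.eq.comp (Primrec.list_length.comp (Primrec.fst.comp .fst)) (.const k)).and
      (hentry.forall_mem_list.comp (Primrec.fst.comp .fst) .snd)
  exact ((Primrec.nat_lt.comp .fst hlength).and (hrow.forall_mem_list.comp .snd .id)).of_eq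
    fun _ => mem_range_code_iff.symm

open Classical in
/-- An automaton is encoded by its description `DFAO.code`. -/
noncomputable instance : Primcodable (DFAO k) :=
  letI : Primcodable (Set.range (code (k := k))) := Primcodable.subtype primrecPred_mem_range_code
  Primcodable.ofEquiv _ (Equiv.ofInjective code code_injective)

theorem encode_code (M : DFAO k) : Encodable.encode M.code = Encodable.encode M := rfl

theorem primrec_code : Primrec (code (k := k)) :=
  Primrec.encode_iff.1 (Primrec.encode.of_eq fun M => M.encode_code.symm)

theorem isDecidable_of_primrecPred {P : DFAO k → Prop} (hP : PrimrecPred P) : IsDecidable P := by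
  classical
  have hdecode : Primrec fun c : ℕ × List (List ℕ × ℕ) =>
      (Encodable.decode₂ (DFAO k) (Encodable.encode c)).map fun M => decide (P M) :=
    Primrec.option_map (Primrec.decode₂.comp .encode) (hP.decide.comp .snd)
  refine ((Primrec.eq.comp hdecode (.const (some true))).of_eq fun c => ?_).computablePred
  simp only [Option.map_eq_some_iff, Encodable.decode₂_eq_some, decide_eq_true_iff,
    ← encode_code, Encodable.encode_inj]

theorem primrec_numStates : Primrec (numStates (k := k)) :=
  (Primrec.list_length.comp (Primrec.snd.comp primrec_code)).of_eq fun M => by simp [code]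

theorem primrec_run (hk : 2 ≤ k) :
    Primrec₂ fun (M : DFAO k) n => (M.run (canonicalRep k hk n) : ℕ) := by
  let next (M : DFAO k) (states : List ℕ) : ℕ :=
    if states.length = 0 then M.code.1
    else (M.code.2.getD (states.getD (states.length / k) 0) ([], 0)).1.getD (states.length % k) 0
  have hnext : Primrec₂ next := by
    have hcode : Primrec fun p : DFAO k × List ℕ => p.1.code := primrec_code.comp .fst
    have hlength : Primrec fun p : DFAO k × List ℕ => p.2.length := Primrec.list_length.comp .snd
    refine Primrec.ite (Primrec.eq.comp hlength (.const 0)) (Primrec.fst.comp hcode) ?_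
    have hprev := (Primrec.list_getD 0).comp (Primrec.snd (α := DFAO k))
      (Primrec.nat_div.comp hlength (.const k))
    have hrow := (Primrec.list_getD ([], 0)).comp (Primrec.snd.comp hcode) hprev
    exact (Primrec.list_getD 0).comp (Primrec.fst.comp hrow)
      (Primrec.nat_mod.comp hlength (.const k))
  refine Primrec.nat_strong_rec _ (Primrec.option_some.comp₂ hnext) fun M n => ?_
  by_cases hn : n = 0
  · simp [next, hn, canonicalRep, run, code]
  · have hdiv : n / k < n := Nat.div_lt_self (by omega) hk
    have hmod : n % k < k := Nat.mod_lt n (by omega)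
    have hrun := M.run_canonicalRep_mul_add hk (n := n / k) ⟨n % k, hmod⟩
      (by rwa [Nat.div_add_mod])
    rw [Nat.div_add_mod] at hrun
    rw [hrun]
    simp [next, hn, code, hdiv, hmod, List.getD_eq_getElem?_getD]

theorem primrec_sequence (hk : 2 ≤ k) : Primrec₂ fun M : DFAO k => M.sequence hk :=
  (Primrec.snd.comp ((Primrec.list_getD ([], 0)).comp (Primrec.snd.comp (primrec_code.comp .fst))
    (primrec_run hk))).of_eq fun p => by simp [code, sequence, List.getD_eq_getElem?_getD]

theorem uniformlyRecognizable_sequence_eq (hk : 2 ≤ k) {n : ℕ} (f g : (Fin n → ℕ) →ₗ[ℕ] ℕ) :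
    UniformlyRecognizable k fun (M : DFAO k) v =>
      M.sequence hk (f v) = M.sequence hk (g v) := by
  have coord : UniformlyRecognizable k fun (M : DFAO k) (v : Fin (n + 1 + 1) → ℕ) =>
      M.sequence hk (v 1) = M.sequence hk (v 0) := by
    have hstates := Primrec.nat_mul.comp (.const 2) (primrec_numStates (k := k))
    have hentry : ∀ i, Primrec fun p : DFAO k × (Fin (n + 1 + 1) → ℕ) => p.1.sequence hk (p.2 i) :=
      fun i => (primrec_sequence hk).comp .fst (Primrec.fin_app.comp .snd (.const i))
    exact ⟨⟨_, Primrec.nat_mul.comp hstates hstates, fun M => M.isRecognizable_sequence_eq hk 1 0⟩,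
      Primrec.eq.comp (hentry 1) (hentry 0)⟩
  exact .subst (R := fun (M : DFAO k) v y => M.sequence hk y = M.sequence hk (g v)) hk f <|
    .subst (R := fun (M : DFAO k) v z => M.sequence hk (v 0) = M.sequence hk z) hk
      (g ∘ₗ LinearMap.funLeft ℕ ℕ Fin.succ) coord

end DFAO

end Automata

section Decidability

variable {k : ℕ}

theorem IsRecognizable.hasArbitrarilyLargePowers_iff_exists_period
    {α : Type*} {x : ℕ → α} {N : ℕ} (hk : 2 ≤ k)
    (h : IsRecognizable k N fun v : Fin 2 → ℕ => ∃ i, (factor x i (v 0)).HasPeriod (v 1)) :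
    HasArbitrarilyLargePowers x ↔
      ∃ p, 0 < p ∧ ∀ B, ∃ n, B ≤ n ∧ ∃ i, (factor x i n).HasPeriod p := by
  rw [hasArbitrarilyLargePowers_iff]
  constructor
  · intro hpow
    obtain ⟨n, p, hp, hn, hper⟩ := hpow (k ^ (N + 1))
    refine ⟨p, hp, h.exists_ge (n := 1) (v := fun _ => p) (L := Nat.log k p + 1)
      (R := fun v n => ∃ i, (factor x i n).HasPeriod (v 0)) hk
      (fun _ => Nat.lt_pow_succ_log_self hk p) ?_ hper⟩
    calc k ^ (Nat.log k p + 1 + N) = k ^ (N + 1) * k ^ Nat.log k p := by ring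
      _ ≤ k ^ (N + 1) * p := by gcongr; exact Nat.pow_log_le_self k hp.ne'
      _ ≤ n := hn
  · rintro ⟨p, hp, hunb⟩ C
    obtain ⟨n, hn, hper⟩ := hunb (C * p)
    exact ⟨n, p, hp, hn, hper⟩

namespace UniformlyRecognizable

theorem isDecidable {P : DFAO k → Prop} (h : UniformlyRecognizable k fun M (_ : Fin 0 → ℕ) => P M) :
    DFAO.IsDecidable P :=
  DFAO.isDecidable_of_primrecPred (h.primrecPred.comp (.pair .id (.const ![])))

theorem hasPeriod_factor {n : ℕ} (hk : 2 ≤ k) (i l p : (Fin n → ℕ) →ₗ[ℕ] ℕ) :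
    UniformlyRecognizable k fun (M : DFAO k) v =>
      (factor (M.sequence hk) (i v) (l v)).HasPeriod (p v) := by
  let weaken := fun f : (Fin n → ℕ) →ₗ[ℕ] ℕ => f ∘ₗ LinearMap.funLeft ℕ ℕ Fin.succ
  let t : (Fin (n + 1) → ℕ) →ₗ[ℕ] ℕ := LinearMap.proj 0
  refine .congr (.all (R := fun (M : DFAO k) v t => t + p v < l v →
    M.sequence hk (i v + t) = M.sequence hk (i v + (t + p v))) hk ?_)
    fun _ _ => hasPeriod_factor_iff.symm
  exact .imp (.lt (by omega) (t + weaken p) (weaken l))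
    (DFAO.uniformlyRecognizable_sequence_eq hk (weaken i + t) (weaken i + (t + weaken p)))

theorem exists_hasPeriod_factor {n : ℕ} (hk : 2 ≤ k) (l p : Fin n) :
    UniformlyRecognizable k fun (M : DFAO k) v =>
      ∃ i, (factor (M.sequence hk) i (v l)).HasPeriod (v p) :=
  .ex (R := fun (M : DFAO k) v i => (factor (M.sequence hk) i (v l)).HasPeriod (v p)) hk <|
    hasPeriod_factor hk (.proj 0) (.proj l.succ) (.proj p.succ)

theorem hasArbitrarilyLargePowers (hk : 2 ≤ k) :
    UniformlyRecognizable k fun (M : DFAO k) (_ : Fin 0 → ℕ) =>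
      HasArbitrarilyLargePowers (M.sequence hk) := by
  obtain ⟨⟨N, -, hN⟩, -⟩ := exists_hasPeriod_factor hk (0 : Fin 2) 1
  refine .congr ?_ fun M _ => ((hN M).hasArbitrarilyLargePowers_iff_exists_period hk).symm
  refine .ex (R := fun (M : DFAO k) _ p => 0 < p ∧
    ∀ B, ∃ n, B ≤ n ∧ ∃ i, (factor (M.sequence hk) i n).HasPeriod p) hk ?_
  refine .and (.lt (by omega) 0 (.proj 0)) ?_
  refine .all (R := fun (M : DFAO k) v B =>
    ∃ n, B ≤ n ∧ ∃ i, (factor (M.sequence hk) i n).HasPeriod (v 0)) hk ?_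
  refine .ex (R := fun (M : DFAO k) v n =>
    v 0 ≤ n ∧ ∃ i, (factor (M.sequence hk) i n).HasPeriod (v 1)) hk ?_
  exact .and (.le (by omega) (.proj 1) (.proj 0)) (exists_hasPeriod_factor hk 0 2)

theorem isBordered_factor {n : ℕ} (hk : 2 ≤ k) (i l : Fin n) :
    UniformlyRecognizable k fun (M : DFAO k) v =>
      IsBordered (factor (M.sequence hk) (v i) (v l)) := by
  refine .congr (.ex (R := fun (M : DFAO k) v p => v l ≤ p + p ∧ p < v l ∧
    (factor (M.sequence hk) (v i) (v l)).HasPeriod p) hk ?_) fun _ _ => by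
      rw [isBordered_iff_hasPeriod, length_factor]
  exact .and (.le (by omega) (.proj l.succ) (.proj 0 + .proj 0)) <|
    .and (.lt (by omega) (.proj 0) (.proj l.succ)) <|
      hasPeriod_factor hk (.proj i.succ) (.proj l.succ) (.proj 0)

theorem hasArbitrarilyLongUnbordered (hk : 2 ≤ k) :
    UniformlyRecognizable k fun (M : DFAO k) (_ : Fin 0 → ℕ) =>
      HasArbitrarilyLongUnbordered (M.sequence hk) := by
  refine .all (R := fun (M : DFAO k) _ N =>
    ∃ i n, N ≤ n ∧ ¬ IsBordered (factor (M.sequence hk) i n)) hk ?_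
  refine .ex (R := fun (M : DFAO k) v i =>
    ∃ n, v 0 ≤ n ∧ ¬ IsBordered (factor (M.sequence hk) i n)) hk ?_
  refine .ex (R := fun (M : DFAO k) v n =>
    v 1 ≤ n ∧ ¬ IsBordered (factor (M.sequence hk) (v 0) n)) hk ?_
  exact .and (.le (by omega) (.proj 2) (.proj 0)) (isBordered_factor hk 1 0).not

end UniformlyRecognizable

end Decidability

theorem mainTheorem5 (k : ℕ) (hk : 2 ≤ k) :
    (∀ M : DFAO k, criticalExponent (M.sequence hk) = ⊤ ↔
      HasArbitrarilyLargePowers (M.sequence hk)) ∧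
    DFAO.IsDecidable (fun M : DFAO k => HasArbitrarilyLargePowers (M.sequence hk)) ∧
    DFAO.IsDecidable (fun M : DFAO k => HasArbitrarilyLongUnbordered (M.sequence hk)) := by
  exact ⟨fun M => criticalExponent_eq_top_iff,
    (UniformlyRecognizable.hasArbitrarilyLargePowers hk).isDecidable,
    (UniformlyRecognizable.hasArbitrarilyLongUnbordered hk).isDecidable⟩
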